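/- Let $X$ be a Tychonoff space. A zero-set of $X$ is a set of the form $g^{-1}(0)$ with $g\colon X\to\mathbb{R}$ continuous, a cozero-set is the complement of a zero-set, and a $Z_\sigma$-set is a union of a sequence of zero-sets. For a subset $A$ of a topological space, $[A]_{seq}$ denotes the set of all limits of sequences of points of $A$; a space $Z$ is sequentially separable if $[D]_{seq}=Z$ for some countable $D\subseteq Z$. Let $C(X)$ be the set of continuous functions $X\to\mathbb{R}$, let $B_1(X)$ be the set of pointwise limits of sequences from $C(X)$, and let $USC_p^f(X)$ be the set of all $f\colon X\to\mathbb{R}$ such that $f^{-1}((-\infty,r))$ is a cozero-set of $X$ for every $r\in\mathbb{R}$; function spaces carry the topology of pointwise convergence. Then the following are equivalent: 1. $USC_p^f(X)$ is sequentially separable; 2. $X$ has the $U$-property, i.e. there is a condensation (a continuous bijection) $\varphi\colon X\to Y$ onto a separable metric space $Y$ such that $\varphi(D)$ is a $Z_\sigma$-set of $Y$ for every zero-set $D$ of $X$; 3. there is a countable set $S\subseteq C(X)$ such that $[S]_{seq}=B_1(X)$. -/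

import Mathlib

open Set Filter Topology

namespace USCSpaces

/-- A zero-set of `X`: the preimage of zero under a continuous real-valued function on `X`. -/
def IsZeroSet {X : Type*} [TopologicalSpace X] (A : Set X) : Prop :=
  ∃ g : X → ℝ, Continuous g ∧ A = g ⁻¹' {0}

/-- A cozero-set of `X`: the complement of a zero-set. -/
def IsCozeroSet {X : Type*} [TopologicalSpace X] (A : Set X) : Prop :=
  IsZeroSet Aᶜ

/-- A `Z_σ`-set of `X`: the union of a sequence of zero-sets. -/
def IsZSigma {X : Type*} [TopologicalSpace X] (A : Set X) : Prop :=
  ∃ Z : ℕ → Set X, (∀ i, IsZeroSet (Z i)) ∧ A = ⋃ i, Z i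

/-- `Z` is sequentially separable: some countable `D ⊆ Z` is sequentially dense, i.e. every point
of `Z` is the limit of a sequence of points of `D`. Mathlib's `seqClosure D` is the set of all
limits of sequences from `D` (a single step, not iterated). -/
def SequentiallySeparable (Z : Type*) [TopologicalSpace Z] : Prop :=
  ∃ D : Set Z, D.Countable ∧ seqClosure D = univ

/-- The functions `f : X → ℝ` such that `f⁻¹((-∞, r))` is a cozero-set for every real `r`.
As a subtype of `X → ℝ` it carries the topology of pointwise convergence. -/
def USCf (X : Type*) [TopologicalSpace X] : Set (X → ℝ) :=
  {f | ∀ r : ℝ, IsCozeroSet (f ⁻¹' Iio r)}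

/-- The Baire functions of class 1: pointwise limits of sequences of continuous real-valued
functions. -/
def BaireOne (X : Type*) [TopologicalSpace X] : Set (X → ℝ) :=
  {f | ∃ g : ℕ → X → ℝ, (∀ n, Continuous (g n)) ∧
    ∀ x, Tendsto (fun n => g n x) atTop (𝓝 (f x))}

/-- The `U`-property: there is a condensation (continuous bijection) of `X` onto a separable metric
space `Y` which maps zero-sets of `X` to `Z_σ`-sets of `Y`. Since `Y` is in bijection with `X`,
taking `Y` in the universe of `X` is no restriction. -/
def UProperty.{u} (X : Type u) [TopologicalSpace X] : Prop :=
  ∃ (Y : Type u) (_ : MetricSpace Y) (_ : TopologicalSpace.SeparableSpace Y) (φ : X → Y),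
    Continuous φ ∧ Function.Bijective φ ∧ ∀ D : Set X, IsZeroSet D → IsZSigma (φ '' D)

end USCSpaces

namespace USCSpaces

section ZeroSets

variable {X : Type*} [TopologicalSpace X]

theorem IsZeroSet.isClosed {A : Set X} (h : IsZeroSet A) : IsClosed A := by
  obtain ⟨g, hg, rfl⟩ := h
  exact isClosed_singleton.preimage hg

theorem isZeroSet_of_isClosed {Y : Type*} [MetricSpace Y] {A : Set Y} (h : IsClosed A) :
    IsZeroSet A := by
  rcases A.eq_empty_or_nonempty with rfl | hne
  · exact ⟨fun _ => 1, continuous_const, by ext; simp⟩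
  · refine ⟨fun x => Metric.infDist x A, Metric.continuous_infDist_pt A, ?_⟩
    ext x
    simp [h.mem_iff_infDist_zero hne]

theorem isZeroSet_le {g : X → ℝ} (hg : Continuous g) (c : ℝ) : IsZeroSet {x | g x ≤ c} := by
  refine ⟨fun x => max (g x - c) 0, by fun_prop, ?_⟩
  ext x
  simp

theorem IsZeroSet.iInter {Z : ℕ → Set X} (hZ : ∀ n, IsZeroSet (Z n)) : IsZeroSet (⋂ n, Z n) := by
  choose g hg hZg using hZ
  have hle : ∀ n x, ‖min |g n x| 1 * (1 / 2 : ℝ) ^ n‖ ≤ (1 / 2 : ℝ) ^ n := by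
    intro n x
    have h1 : 0 ≤ min |g n x| 1 := le_min (abs_nonneg _) zero_le_one
    rw [Real.norm_of_nonneg (by positivity)]
    exact mul_le_of_le_one_left (by positivity) (min_le_right _ _)
  have hs : Summable fun n : ℕ => (1 / 2 : ℝ) ^ n := summable_geometric_two
  refine ⟨fun x => ∑' n, min |g n x| 1 * (1 / 2 : ℝ) ^ n,
    continuous_tsum (fun n => ?_) hs hle, ?_⟩
  · have := hg n
    fun_prop
  · ext x
    have hsx : Summable fun n => min |g n x| 1 * (1 / 2 : ℝ) ^ n :=
      Summable.of_norm_bounded hs fun n => hle n x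
    have h0 : ∀ n, 0 ≤ min |g n x| 1 * (1 / 2 : ℝ) ^ n := fun n =>
      mul_nonneg (le_min (abs_nonneg _) zero_le_one) (by positivity)
    have hmin : ∀ n, min |g n x| 1 = 0 ↔ g n x = 0 := by
      intro n
      rcases min_choice |g n x| 1 with h | h
      · rw [h, abs_eq_zero]
      · rw [h]
        refine ⟨fun h1 => absurd h1 one_ne_zero, fun h1 => ?_⟩
        simp [h1] at h
    have key : ∑' n, min |g n x| 1 * (1 / 2 : ℝ) ^ n = 0 ↔ ∀ n, g n x = 0 := by
      rw [← hsx.hasSum_iff, hasSum_zero_iff_of_nonneg h0, funext_iff]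
      refine forall_congr' fun n => ?_
      rw [← hmin n]
      simp
    simp only [mem_iInter, mem_preimage, mem_singleton_iff, key]
    refine forall_congr' fun n => ?_
    rw [hZg n]
    simp

theorem IsZeroSet.isZSigma {A : Set X} (h : IsZeroSet A) : IsZSigma A :=
  ⟨fun _ => A, fun _ => h, (iUnion_const A).symm⟩

theorem IsZSigma.iUnion {A : ℕ → Set X} (h : ∀ n, IsZSigma (A n)) : IsZSigma (⋃ n, A n) := by
  choose Z hZ hA using h
  refine ⟨fun n => Z n.unpair.1 n.unpair.2, fun n => hZ _ _, ?_⟩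
  rw [Set.iUnion_unpair Z]
  exact iUnion_congr hA

theorem IsCozeroSet.isZSigma {A : Set X} (h : IsCozeroSet A) : IsZSigma A := by
  obtain ⟨g, hg, hA⟩ := h
  refine ⟨fun n => {x | -|g x| ≤ -(1 / ((n : ℝ) + 1))}, fun n => isZeroSet_le (by fun_prop) _, ?_⟩
  ext x
  have hx : x ∈ A ↔ g x ≠ 0 := by
    rw [← not_iff_not, ← mem_compl_iff, hA]
    simp
  simp only [mem_iUnion, mem_ofPred_eq, neg_le_neg_iff]
  rw [hx]
  constructor
  · intro h
    obtain ⟨n, hn⟩ := exists_nat_one_div_lt (abs_pos.2 h)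
    exact ⟨n, hn.le⟩
  · rintro ⟨n, hn⟩
    exact abs_pos.1 (lt_of_lt_of_le (by positivity) hn)

theorem continuous_mem_USCf {f : X → ℝ} (hf : Continuous f) : f ∈ USCf X := by
  intro r
  have := isZeroSet_le (g := fun x => -f x) (by fun_prop) (-r)
  have e : (f ⁻¹' Iio r)ᶜ = {x | -f x ≤ -r} := by
    ext x
    simp
  rw [IsCozeroSet, e]
  exact this

theorem isZSigma_Iio_of_mem_USCf {f : X → ℝ} (hf : f ∈ USCf X) (r : ℝ) :
    IsZSigma (f ⁻¹' Iio r) :=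
  (hf r).isZSigma

theorem isZSigma_Ioi_of_mem_USCf {f : X → ℝ} (hf : f ∈ USCf X) (r : ℝ) :
    IsZSigma (f ⁻¹' Ioi r) := by
  refine ⟨fun n => (f ⁻¹' Iio (r + 1 / ((n : ℝ) + 1)))ᶜ, fun n => hf _, ?_⟩
  ext x
  simp only [mem_preimage, mem_Ioi, mem_iUnion, mem_compl_iff, mem_Iio, not_lt]
  constructor
  · intro h
    obtain ⟨n, hn⟩ := exists_nat_one_div_lt (sub_pos.2 h)
    exact ⟨n, by linarith⟩
  · rintro ⟨n, hn⟩
    have : 0 < 1 / ((n : ℝ) + 1) := by positivity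
    linarith

theorem isZSigma_Iio_of_mem_baireOne {f : X → ℝ} (hf : f ∈ BaireOne X) (r : ℝ) :
    IsZSigma (f ⁻¹' Iio r) := by
  obtain ⟨g, hg, hlim⟩ := hf
  have e : f ⁻¹' Iio r =
      ⋃ q : ℕ, ⋃ N : ℕ, ⋂ n : ℕ, {x | g (N + n) x ≤ r - 1 / ((q : ℝ) + 1)} := by
    ext x
    simp only [mem_preimage, mem_Iio, mem_iUnion, mem_iInter, mem_ofPred_eq]
    constructor
    · intro h
      obtain ⟨q, hq⟩ := exists_nat_one_div_lt (sub_pos.2 h)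
      obtain ⟨N, hN⟩ := eventually_atTop.1
        ((hlim x).eventually_lt_const (u := r - 1 / ((q : ℝ) + 1)) (by linarith))
      exact ⟨q, N, fun n => (hN _ (Nat.le_add_right _ _)).le⟩
    · rintro ⟨q, N, h⟩
      have h1 : f x ≤ r - 1 / ((q : ℝ) + 1) := by
        refine le_of_tendsto (hlim x) (eventually_atTop.2 ⟨N, fun n hn => ?_⟩)
        obtain ⟨m, rfl⟩ := Nat.exists_eq_add_of_le hn
        exact h m
      have : 0 < 1 / ((q : ℝ) + 1) := by positivity
      linarith
  rw [e]
  exact .iUnion fun q => .iUnion fun N =>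
    (IsZeroSet.iInter fun n => isZeroSet_le (hg _) _).isZSigma

theorem isZSigma_Ioi_of_mem_baireOne {f : X → ℝ} (hf : f ∈ BaireOne X) (r : ℝ) :
    IsZSigma (f ⁻¹' Ioi r) := by
  obtain ⟨g, hg, hlim⟩ := hf
  have := isZSigma_Iio_of_mem_baireOne (f := fun x => -f x)
    ⟨fun n x => -g n x, fun n => (hg n).neg, fun x => (hlim x).neg⟩ (-r)
  have e : f ⁻¹' Ioi r = (fun x => -f x) ⁻¹' Iio (-r) := by
    ext x
    simp
  rwa [e]

theorem IsZeroSet.indicator_mem_USCf {Z : Set X} (hZ : IsZeroSet Z) :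
    Z.indicator (fun _ => (1 : ℝ)) ∈ USCf X := by
  intro r
  have hempty : IsZeroSet (∅ : Set X) := ⟨fun _ => 1, continuous_const, by ext; simp⟩
  have huniv : IsZeroSet (univ : Set X) := ⟨fun _ => 0, continuous_const, by ext; simp⟩
  rw [IsCozeroSet]
  rcases le_or_gt r 0 with h | h
  · convert huniv
    ext x
    by_cases hx : x ∈ Z <;> simp [hx] <;> linarith
  rcases le_or_gt r 1 with h1 | h1
  · convert hZ
    ext x
    by_cases hx : x ∈ Z <;> simp [hx] <;> linarith
  · convert hempty
    ext x
    by_cases hx : x ∈ Z <;> simp [hx] <;> linarith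

theorem IsZeroSet.indicator_mem_baireOne {Z : Set X} (hZ : IsZeroSet Z) :
    Z.indicator (fun _ => (1 : ℝ)) ∈ BaireOne X := by
  obtain ⟨g, hg, rfl⟩ := hZ
  refine ⟨fun n x => 1 - min 1 (n * |g x|), fun n => by fun_prop, fun x => ?_⟩
  by_cases hx : g x = 0
  · simp [hx]
  · refine tendsto_const_nhds.congr' ?_
    obtain ⟨N, hN⟩ := exists_nat_gt (1 / |g x|)
    have hpos : 0 < |g x| := abs_pos.2 hx
    filter_upwards [eventually_ge_atTop N] with n hn
    have : 1 ≤ n * |g x| := by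
      have h1 : (N : ℝ) ≤ n := by exact_mod_cast hn
      rw [div_lt_iff₀ hpos] at hN
      nlinarith
    simp [hx, min_eq_left this]

end ZeroSets

section Condensation

theorem uProperty_of_indicator_limits {X : Type*} [TopologicalSpace X] [T35Space X]
    {D : Set (X → ℝ)} (hD : D.Countable) (hDu : D ⊆ USCf X)
    (h : ∀ Z : Set X, IsZeroSet Z → ∃ d : ℕ → X → ℝ, (∀ n, d n ∈ D) ∧
      ∀ x, Tendsto (fun n => d n x) atTop (𝓝 (Z.indicator (fun _ => (1 : ℝ)) x))) :
    UProperty X := by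
  have hg : ∀ d : D, ∃ g : X → ℝ, Continuous g ∧ ∀ x, g x = 0 ↔ (1 / 2 : ℝ) ≤ d.1 x := by
    intro d
    obtain ⟨g, hg, he⟩ := hDu d.2 (1 / 2)
    refine ⟨g, hg, fun x => ?_⟩
    have : x ∈ (d.1 ⁻¹' Iio (1 / 2 : ℝ))ᶜ ↔ x ∈ g ⁻¹' {0} := by rw [he]
    simpa using this.symm
  choose g hgc hg0 using hg
  have : Countable D := hD.to_subtype
  let φ : X → (D → ℝ) := fun x d => g d x
  have hφ : Continuous φ := continuous_pi fun d => hgc d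
  have hmem : ∀ {Z : Set X} {d : ℕ → X → ℝ}, (∀ n, d n ∈ D) →
      (∀ x, Tendsto (fun n => d n x) atTop (𝓝 (Z.indicator (fun _ => (1 : ℝ)) x))) →
      ∀ x, x ∈ Z ↔ ∃ n, ∀ m, (1 / 2 : ℝ) ≤ d (n + m) x := by
    intro Z d _ hlim x
    have hx := hlim x
    constructor
    · intro hxZ
      rw [indicator_of_mem hxZ] at hx
      obtain ⟨N, hN⟩ := eventually_atTop.1 (hx.eventually_const_lt (u := 1 / 2) (by norm_num))
      exact ⟨N, fun m => (hN _ (Nat.le_add_right _ _)).le⟩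
    · rintro ⟨N, hN⟩
      by_contra hxZ
      rw [indicator_of_notMem hxZ] at hx
      obtain ⟨M, hM⟩ := eventually_atTop.1 (hx.eventually_lt_const (u := 1 / 2) (by norm_num))
      have h1 := hN M
      have h2 := hM (N + M) (Nat.le_add_left _ _)
      linarith
  have hinj : Function.Injective φ := by
    intro x y hxy
    by_contra hne
    obtain ⟨f, hf, hfx, hfy⟩ := CompletelyRegularSpace.completely_regular x {y}
      isClosed_singleton (by simpa using hne)
    have hfy : f y = 1 := hfy rfl
    obtain ⟨d, hd, hlim⟩ := h ((fun z => (f z : ℝ)) ⁻¹' {0}) ⟨_, by fun_prop, rfl⟩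
    have hx := (hmem hd hlim x).1 (by simp [hfx])
    obtain ⟨n, hn⟩ := hx
    have hy : y ∈ (fun z => (f z : ℝ)) ⁻¹' {0} := by
      refine (hmem hd hlim y).2 ⟨n, fun m => ?_⟩
      have e : g ⟨d (n + m), hd _⟩ x = g ⟨d (n + m), hd _⟩ y := congrFun hxy ⟨d (n + m), hd _⟩
      rw [← hg0 ⟨d (n + m), hd _⟩ y, ← e, hg0]
      exact hn m
    simp [hfy] at hy
  let _ : MetricSpace (D → ℝ) := TopologicalSpace.metrizableSpaceMetric (D → ℝ)
  refine ⟨range φ, inferInstance, inferInstance, rangeFactorization φ, hφ.rangeFactorization,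
    ⟨(rangeFactorization_injective).2 hinj, rangeFactorization_surjective⟩, fun Z hZ => ?_⟩
  obtain ⟨d, hd, hlim⟩ := h Z hZ
  refine ⟨fun n => ⋂ m, {y : range φ | y.1 ⟨d (n + m), hd _⟩ = 0}, fun n => ?_, ?_⟩
  · refine isZeroSet_of_isClosed (isClosed_iInter fun m => isClosed_eq ?_ continuous_const)
    exact (continuous_apply _).comp continuous_subtype_val
  · ext ⟨_, x, rfl⟩
    have e : (⟨φ x, x, rfl⟩ : range φ) ∈ rangeFactorization φ '' Z ↔ x ∈ Z := by
      constructor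
      · rintro ⟨z, hz, he⟩
        rwa [← hinj (congrArg Subtype.val he)]
      · exact fun hx => ⟨x, hx, rfl⟩
    rw [e, hmem hd hlim]
    simp [φ, hg0]

end Condensation

section Blend

variable {Y : Type*} [MetricSpace Y]

/-- The continuous bump supported on the ball of radius `1 / (k + 1)` around `y i`. -/
noncomputable def bump (y : ℕ → Y) (i k : ℕ) (x : Y) : ℝ :=
  max 0 (1 / ((k : ℝ) + 1) - dist x (y i))

/-- Iterated weighted averages of the coefficients `a (i, k)`, `i < n`, in which the balls of
smaller radius take precedence over the larger ones. -/
noncomputable def blend (y : ℕ → Y) (a : ℕ × ℕ → ℝ) (n : ℕ) : ℕ → Y → ℝ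
  | 0, _ => 0
  | k + 1, x => blend y a n k x +
      (∑ i ∈ Finset.range n, bump y i k x * (a (i, k) - blend y a n k x)) /
        max (∑ i ∈ Finset.range n, bump y i k x) (1 / ((n : ℝ) + 1))

theorem bump_nonneg (y : ℕ → Y) (i k : ℕ) (x : Y) : 0 ≤ bump y i k x := le_max_left _ _

theorem bump_pos_iff {y : ℕ → Y} {i k : ℕ} {x : Y} :
    0 < bump y i k x ↔ dist x (y i) < 1 / ((k : ℝ) + 1) := by
  rw [bump, lt_max_iff, sub_pos]
  simp

theorem continuous_bump (y : ℕ → Y) (i k : ℕ) : Continuous (bump y i k) := by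
  unfold bump
  fun_prop

theorem continuous_blend (y : ℕ → Y) (a : ℕ × ℕ → ℝ) (n k : ℕ) : Continuous (blend y a n k) := by
  induction k with
  | zero => exact continuous_const
  | succ k ih =>
    have hb := fun i => continuous_bump y i k
    refine ih.add (Continuous.div ?_ ?_ fun x => ?_)
    · fun_prop
    · fun_prop
    · exact (lt_max_of_lt_right (by positivity)).ne'

theorem blend_congr (y : ℕ → Y) {a b : ℕ × ℕ → ℝ} {n k : ℕ}
    (h : ∀ i < n, ∀ j < k, a (i, j) = b (i, j)) (x : Y) : blend y a n k x = blend y b n k x := by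
  induction k with
  | zero => rfl
  | succ k ih =>
    have ih := ih fun i hi j hj => h i hi j (by omega)
    simp only [blend, ih]
    congr 2
    refine Finset.sum_congr rfl fun i hi => ?_
    rw [h i (Finset.mem_range.1 hi) k (Nat.lt_succ_self k)]

theorem abs_weighted_sum_le {y : ℕ → Y} {a : ℕ × ℕ → ℝ} {k n : ℕ} {x : Y} {c ε : ℝ}
    (ha : ∀ i, dist x (y i) < 1 / ((k : ℝ) + 1) → |a (i, k) - c| ≤ ε) :
    |∑ i ∈ Finset.range n, bump y i k x * (a (i, k) - c)| ≤
      (∑ i ∈ Finset.range n, bump y i k x) * ε := by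
  refine (Finset.abs_sum_le_sum_abs _ _).trans ?_
  rw [Finset.sum_mul]
  refine Finset.sum_le_sum fun i _ => ?_
  rw [abs_mul, abs_of_nonneg (bump_nonneg y i k x)]
  rcases (bump_nonneg y i k x).eq_or_lt with h0 | h0
  · simp [← h0]
  · exact mul_le_mul_of_nonneg_left (ha i (bump_pos_iff.1 h0)) h0.le

theorem blend_succ_sub (y : ℕ → Y) (a : ℕ × ℕ → ℝ) (n k : ℕ) (x : Y) (c : ℝ) :
    blend y a n (k + 1) x - c =
      (1 - (∑ i ∈ Finset.range n, bump y i k x) /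
        max (∑ i ∈ Finset.range n, bump y i k x) (1 / ((n : ℝ) + 1))) * (blend y a n k x - c) +
      (∑ i ∈ Finset.range n, bump y i k x * (a (i, k) - c)) /
        max (∑ i ∈ Finset.range n, bump y i k x) (1 / ((n : ℝ) + 1)) := by
  simp only [blend, mul_sub, Finset.sum_sub_distrib, ← Finset.sum_mul]
  ring

theorem abs_blend_succ_sub_le {y : ℕ → Y} {a : ℕ × ℕ → ℝ} {n k : ℕ} {x : Y} {c ε : ℝ}
    (ha : ∀ i, dist x (y i) < 1 / ((k : ℝ) + 1) → |a (i, k) - c| ≤ ε)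
    (h : |blend y a n k x - c| ≤ ε ∨
      1 / ((n : ℝ) + 1) ≤ ∑ i ∈ Finset.range n, bump y i k x) :
    |blend y a n (k + 1) x - c| ≤ ε := by
  rw [blend_succ_sub]
  have hw := abs_weighted_sum_le (n := n) ha
  set s := ∑ i ∈ Finset.range n, bump y i k x
  set t := ∑ i ∈ Finset.range n, bump y i k x * (a (i, k) - c)
  have hn : 0 < 1 / ((n : ℝ) + 1) := by positivity
  have hM : 0 < max s (1 / ((n : ℝ) + 1)) := lt_max_of_lt_right hn
  have ht : |t / max s (1 / ((n : ℝ) + 1))| ≤ s / max s (1 / ((n : ℝ) + 1)) * ε := by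
    rw [abs_div, abs_of_pos hM, div_mul_eq_mul_div]
    gcongr
  rcases h with h | h
  · have h1 : 0 ≤ 1 - s / max s (1 / ((n : ℝ) + 1)) :=
      sub_nonneg.2 ((div_le_one hM).2 (le_max_left _ _))
    refine (abs_add_le _ _).trans ?_
    rw [abs_mul, abs_of_nonneg h1]
    have := mul_le_mul_of_nonneg_left h h1
    linarith
  · have h1 : s / max s (1 / ((n : ℝ) + 1)) = 1 := by
      rw [max_eq_left h, div_self (hn.trans_le h).ne']
    rw [h1] at ht ⊢
    simpa using ht

theorem tendsto_blend {y : ℕ → Y} (hy : DenseRange y) {a : ℕ × ℕ → ℝ} {x : Y} {c : ℝ}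
    (ha : ∀ ε > 0, ∃ K : ℕ, ∀ k ≥ K, ∀ i,
      dist x (y i) < 1 / ((k : ℝ) + 1) → |a (i, k) - c| ≤ ε) :
    Tendsto (fun n => blend y a n n x) atTop (𝓝 c) := by
  refine Metric.tendsto_atTop.2 fun ε hε => ?_
  obtain ⟨K, hK⟩ := ha (ε / 2) (half_pos hε)
  obtain ⟨i, hi⟩ := hy.exists_dist_lt x (ε := 1 / ((K : ℝ) + 1)) (by positivity)
  obtain ⟨N, hN⟩ := exists_nat_one_div_lt (bump_pos_iff.2 hi)
  refine ⟨max (max (i + 1) N) (K + 1), fun n hn => ?_⟩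
  have hn1 : i < n := by omega
  have hn2 : N ≤ n := by omega
  have hn3 : K + 1 ≤ n := by omega
  have key : ∀ k, K + 1 ≤ k → |blend y a n k x - c| ≤ ε / 2 := by
    intro k hk
    induction k, hk using Nat.le_induction with
    | base =>
      refine abs_blend_succ_sub_le (hK K le_rfl) (Or.inr ?_)
      have h1 : bump y i K x ≤ ∑ i ∈ Finset.range n, bump y i K x :=
        Finset.single_le_sum (f := fun i => bump y i K x) (fun j _ => bump_nonneg y j K x)
          (Finset.mem_range.2 hn1)
      have h2 : 1 / ((n : ℝ) + 1) ≤ 1 / ((N : ℝ) + 1) := by gcongr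
      linarith
    | succ k hk ih => exact abs_blend_succ_sub_le (hK k (by omega)) (Or.inl ih)
  rw [Real.dist_eq]
  linarith [key n hn3]

end Blend

section Approximation

variable {Y : Type*} [MetricSpace Y]

theorem exists_closed_cover_small_osc {f : Y → ℝ} (hlt : ∀ r, IsZSigma (f ⁻¹' Iio r))
    (hgt : ∀ r, IsZSigma (f ⁻¹' Ioi r)) {ε : ℝ} (hε : 0 < ε) :
    ∃ A : ℕ → Set Y, (∀ j, IsClosed (A j)) ∧ (∀ x, ∃ j, x ∈ A j) ∧
      ∀ j, ∀ x ∈ A j, ∀ z ∈ A j, |f x - f z| < ε := by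
  choose L hL hfL using hlt
  choose U hU hfU using hgt
  obtain ⟨e, he⟩ := exists_surjective_nat (ℚ × ℕ × ℕ)
  refine ⟨fun n => L ((e n).1 + ε / 2) (e n).2.1 ∩ U ((e n).1 - ε / 2) (e n).2.2,
    fun n => (hL _ _).isClosed.inter (hU _ _).isClosed, fun x => ?_, fun n => ?_⟩
  · obtain ⟨q, hq1, hq2⟩ := exists_rat_btwn (show f x - ε / 2 < f x + ε / 2 by linarith)
    have h1 : x ∈ f ⁻¹' Iio (q + ε / 2) := by
      rw [mem_preimage, mem_Iio]
      linarith
    have h2 : x ∈ f ⁻¹' Ioi (q - ε / 2) := by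
      rw [mem_preimage, mem_Ioi]
      linarith
    rw [hfL] at h1
    rw [hfU] at h2
    obtain ⟨i, hi⟩ := mem_iUnion.1 h1
    obtain ⟨j, hj⟩ := mem_iUnion.1 h2
    obtain ⟨n, hn⟩ := he (q, i, j)
    refine ⟨n, ?_⟩
    simp only [hn]
    exact ⟨hi, hj⟩
  · have key : ∀ x ∈ L ((e n).1 + ε / 2) (e n).2.1 ∩ U ((e n).1 - ε / 2) (e n).2.2,
        f x < (e n).1 + ε / 2 ∧ (e n).1 - ε / 2 < f x := by
      rintro x ⟨h1, h2⟩
      have h1 := mem_iUnion_of_mem _ h1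
      have h2 := mem_iUnion_of_mem _ h2
      rw [← hfL] at h1
      rw [← hfU] at h2
      exact ⟨h1, h2⟩
    intro x hx z hz
    obtain ⟨h1, h2⟩ := key x hx
    obtain ⟨h3, h4⟩ := key z hz
    rw [abs_lt]
    constructor <;> linarith

theorem exists_sample_points (y : ℕ → Y) {A : ℕ → ℕ → Set Y} (hc : ∀ m j, IsClosed (A m j))
    (hcov : ∀ m x, ∃ j, x ∈ A m j) :
    ∃ z : ℕ × ℕ → Y, ∀ x M, ∃ K : ℕ, ∀ k ≥ K, ∀ i, dist x (y i) < 1 / ((k : ℝ) + 1) →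
      ∃ j, x ∈ A M j ∧ z (i, k) ∈ A M j := by
  classical
  have hJ : ∀ (m : ℕ) (p : ℕ × ℕ), ∃ j,
      (A m j ∩ Metric.ball (y p.1) (1 / ((p.2 : ℝ) + 1))).Nonempty := by
    intro m p
    obtain ⟨j, hj⟩ := hcov m (y p.1)
    exact ⟨j, y p.1, hj, Metric.mem_ball_self (by positivity)⟩
  let J : ℕ → ℕ × ℕ → ℕ := fun m p => Nat.find (hJ m p)
  let P : ℕ × ℕ → ℕ → Prop := fun p M => ∃ z, ∀ m < M, z ∈ A m (J m p)
  have hP0 : ∀ p, P p 0 := fun p => ⟨y 0, fun m hm => absurd hm (Nat.not_lt_zero m)⟩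
  have hP : ∀ p, P p (Nat.findGreatest (P p) p.2) := fun p =>
    Nat.findGreatest_spec (Nat.zero_le _) (hP0 p)
  choose z hz using hP
  have hstab : ∀ (x : Y) (m : ℕ), ∃ j, x ∈ A m j ∧ ∀ᶠ k : ℕ in atTop, ∀ i,
      dist x (y i) < 1 / ((k : ℝ) + 1) → J m (i, k) = j := by
    intro x m
    refine ⟨Nat.find (hcov m x), Nat.find_spec (hcov m x), ?_⟩
    have hclosed : IsClosed (⋃ j ∈ Finset.range (Nat.find (hcov m x)), A m j) :=
      isClosed_biUnion_finset fun j _ => hc m j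
    have hx : x ∈ (⋃ j ∈ Finset.range (Nat.find (hcov m x)), A m j)ᶜ := by
      simp only [mem_compl_iff, mem_iUnion, not_exists, Finset.mem_range]
      exact fun j hj => Nat.find_min (hcov m x) hj
    obtain ⟨δ, hδ, hball⟩ := Metric.isOpen_iff.1 hclosed.isOpen_compl x hx
    obtain ⟨K, hK⟩ := exists_nat_one_div_lt (half_pos hδ)
    filter_upwards [eventually_ge_atTop K] with k hk i hi
    have hk' : 1 / ((k : ℝ) + 1) ≤ 1 / ((K : ℝ) + 1) := by gcongr
    refine (Nat.find_eq_iff _).2 ⟨⟨x, Nat.find_spec (hcov m x), hi⟩, ?_⟩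
    rintro j hj ⟨w, hwA, hw⟩
    have hwx : w ∈ Metric.ball x δ := by
      rw [Metric.mem_ball] at hw ⊢
      have := dist_triangle_right w x (y i)
      simp only at hw
      linarith
    exact hball hwx (mem_biUnion (Finset.mem_coe.2 (Finset.mem_range.2 hj)) hwA)
  refine ⟨z, fun x M => ?_⟩
  choose j hj hev using hstab x
  have hall : ∀ᶠ k : ℕ in atTop, ∀ m ∈ Finset.range (M + 1), ∀ i,
      dist x (y i) < 1 / ((k : ℝ) + 1) → J m (i, k) = j m :=
    (Filter.eventually_all_finset _).2 fun m _ => hev m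
  obtain ⟨K, hK⟩ := eventually_atTop.1 (hall.and (eventually_ge_atTop (M + 1)))
  refine ⟨K, fun k hk i hi => ⟨j M, hj M, ?_⟩⟩
  obtain ⟨hJk, hMk⟩ := hK k hk
  have hJk : ∀ m < M + 1, J m (i, k) = j m := fun m hm => hJk m (Finset.mem_range.2 hm) i hi
  have hPM : P (i, k) (M + 1) := ⟨x, fun m hm => by rw [hJk m hm]; exact hj m⟩
  have := hz (i, k) M (Nat.lt_of_succ_le (Nat.le_findGreatest hMk hPM))
  rwa [hJk M (Nat.lt_succ_self M)] at this

theorem exists_countable_seqDense_of_separable [TopologicalSpace.SeparableSpace Y] :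
    ∃ S : Set (Y → ℝ), S.Countable ∧ (∀ f ∈ S, Continuous f) ∧
      ∀ f : Y → ℝ, (∀ r, IsZSigma (f ⁻¹' Iio r)) → (∀ r, IsZSigma (f ⁻¹' Ioi r)) →
        ∃ s : ℕ → Y → ℝ, (∀ n, s n ∈ S) ∧ ∀ x, Tendsto (fun n => s n x) atTop (𝓝 (f x)) := by
  rcases isEmpty_or_nonempty Y with hY | hY
  · exact ⟨{0}, countable_singleton 0, fun f hf => by rw [hf]; exact continuous_zero,
      fun f _ _ => ⟨fun _ => 0, fun _ => rfl, fun x => isEmptyElim x⟩⟩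
  obtain ⟨y, hy⟩ := TopologicalSpace.exists_dense_seq Y
  refine ⟨range fun p : ℕ × (ℕ × ℕ →₀ ℚ) => blend y (fun e => (p.2 e : ℝ)) p.1 p.1,
    countable_range _, ?_, fun f hlt hgt => ?_⟩
  · rintro _ ⟨p, rfl⟩
    exact continuous_blend _ _ _ _
  have hcover := fun m : ℕ =>
    exists_closed_cover_small_osc hlt hgt (ε := 1 / ((m : ℝ) + 1)) (by positivity)
  choose A hAc hAcov hA using hcover
  obtain ⟨z, hz⟩ := exists_sample_points y hAc hAcov
  have hq : ∀ p : ℕ × ℕ, ∃ q : ℚ, |f (z p) - q| < 1 / ((p.2 : ℝ) + 1) := fun p =>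
    exists_rat_near (f (z p)) (by positivity)
  choose q hq using hq
  refine ⟨fun n => blend y (fun e => (q e : ℝ)) n n, fun n => ?_, fun x => tendsto_blend hy ?_⟩
  · refine ⟨(n, Finsupp.indicator (Finset.range n ×ˢ Finset.range n) fun e _ => q e),
      funext fun x => blend_congr y (fun i hi j hj => ?_) x⟩
    rw [Finsupp.indicator_of_mem (by simp [hi, hj])]
  · intro ε hε
    obtain ⟨M, hM⟩ := exists_nat_one_div_lt (half_pos hε)
    obtain ⟨K, hK⟩ := hz x M
    refine ⟨max K M, fun k hk i hi => ?_⟩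
    obtain ⟨j, hxj, hzj⟩ := hK k (le_of_max_le_left hk) i hi
    have h1 := hA M j _ hzj _ hxj
    have h2 := hq (i, k)
    have h3 : 1 / ((k : ℝ) + 1) ≤ 1 / ((M : ℝ) + 1) := by
      have : M ≤ k := le_of_max_le_right hk
      gcongr
    simp only at h2
    rw [abs_lt] at h1 h2
    rw [abs_le]
    constructor <;> linarith

end Approximation

section Equivalence

variable {X : Type*} [TopologicalSpace X]

theorem UProperty.exists_countable_seqDense (h : UProperty X) :
    ∃ S : Set (X → ℝ), S.Countable ∧ (∀ f ∈ S, Continuous f) ∧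
      ∀ f : X → ℝ, (∀ r, IsZSigma (f ⁻¹' Iio r)) → (∀ r, IsZSigma (f ⁻¹' Ioi r)) →
        ∃ s : ℕ → X → ℝ, (∀ n, s n ∈ S) ∧ ∀ x, Tendsto (fun n => s n x) atTop (𝓝 (f x)) := by
  obtain ⟨Y, _, _, φ, hφ, hbij, hZ⟩ := h
  obtain ⟨S, hS, hSc, hlim⟩ := exists_countable_seqDense_of_separable (Y := Y)
  have himage : ∀ A : Set X, IsZSigma A → IsZSigma (φ '' A) := by
    rintro _ ⟨Z, hZ', rfl⟩
    rw [image_iUnion]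
    exact .iUnion fun i => hZ _ (hZ' i)
  let e := Equiv.ofBijective φ hbij
  have hpre : ∀ (f : X → ℝ) (B : Set ℝ), (f ∘ e.symm) ⁻¹' B = φ '' (f ⁻¹' B) := by
    intro f B
    rw [preimage_comp, ← e.image_eq_preimage_symm]
    rfl
  refine ⟨(fun s => s ∘ φ) '' S, hS.image _, ?_, fun f hlt hgt => ?_⟩
  · rintro _ ⟨s, hs, rfl⟩
    exact (hSc s hs).comp hφ
  · obtain ⟨s, hs, hsf⟩ := hlim (f ∘ e.symm) (fun r => hpre f _ ▸ himage _ (hlt r))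
      fun r => hpre f _ ▸ himage _ (hgt r)
    refine ⟨fun n => s n ∘ φ, fun n => ⟨s n, hs n, rfl⟩, fun x => ?_⟩
    have := hsf (φ x)
    have hx : e.symm (φ x) = x := e.symm_apply_apply x
    rwa [Function.comp_apply, hx] at this

theorem UProperty.sequentiallySeparable (h : UProperty X) : SequentiallySeparable (USCf X) := by
  obtain ⟨S, hS, hSc, hlim⟩ := h.exists_countable_seqDense
  refine ⟨Subtype.val ⁻¹' S, hS.preimage Subtype.val_injective, eq_univ_of_forall fun f => ?_⟩
  obtain ⟨s, hs, hsf⟩ := hlim f.1 (isZSigma_Iio_of_mem_USCf f.2) (isZSigma_Ioi_of_mem_USCf f.2)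
  refine ⟨fun n => ⟨s n, continuous_mem_USCf (hSc _ (hs n))⟩, hs, ?_⟩
  exact tendsto_subtype_rng.2 (tendsto_pi_nhds.2 hsf)

theorem UProperty.exists_seqClosure_eq_baireOne (h : UProperty X) :
    ∃ S : Set (X → ℝ), S.Countable ∧ (∀ f ∈ S, Continuous f) ∧ seqClosure S = BaireOne X := by
  obtain ⟨S, hS, hSc, hlim⟩ := h.exists_countable_seqDense
  refine ⟨S, hS, hSc, Subset.antisymm ?_ fun f hf => ?_⟩
  · rintro f ⟨s, hs, hsf⟩
    exact ⟨s, fun n => hSc _ (hs n), tendsto_pi_nhds.1 hsf⟩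
  · obtain ⟨s, hs, hsf⟩ :=
      hlim f (isZSigma_Iio_of_mem_baireOne hf) (isZSigma_Ioi_of_mem_baireOne hf)
    exact ⟨s, hs, tendsto_pi_nhds.2 hsf⟩

theorem SequentiallySeparable.uProperty [T35Space X] (h : SequentiallySeparable (USCf X)) :
    UProperty X := by
  obtain ⟨D, hD, hDs⟩ := h
  refine uProperty_of_indicator_limits (hD.image Subtype.val)
    (image_subset_iff.2 fun d _ => d.2) fun Z hZ => ?_
  have hmem : (⟨_, hZ.indicator_mem_USCf⟩ : USCf X) ∈ seqClosure D := hDs ▸ mem_univ _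
  obtain ⟨d, hd, hlim⟩ := hmem
  exact ⟨fun n => (d n).1, fun n => ⟨d n, hd n, rfl⟩,
    tendsto_pi_nhds.1 (tendsto_subtype_rng.1 hlim)⟩

theorem uProperty_of_seqClosure_eq_baireOne [T35Space X] {S : Set (X → ℝ)} (hS : S.Countable)
    (hSc : ∀ f ∈ S, Continuous f) (h : seqClosure S = BaireOne X) : UProperty X := by
  refine uProperty_of_indicator_limits hS (fun f hf => continuous_mem_USCf (hSc f hf))
    fun Z hZ => ?_
  have hmem := hZ.indicator_mem_baireOne
  rw [← h] at hmem
  obtain ⟨d, hd, hlim⟩ := hmem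
  exact ⟨d, hd, tendsto_pi_nhds.1 hlim⟩

end Equivalence

end USCSpaces

theorem theorem3p2 {X : Type*} [TopologicalSpace X] [T35Space X] :
    List.TFAE [
      USCSpaces.SequentiallySeparable (USCSpaces.USCf X),
      USCSpaces.UProperty X,
      ∃ S : Set (X → ℝ), S.Countable ∧ (∀ f ∈ S, Continuous f) ∧
        seqClosure S = USCSpaces.BaireOne X] := by
  tfae_have 1 → 2 := fun h => h.uProperty
  tfae_have 2 → 1 := fun h => h.sequentiallySeparable
  tfae_have 2 → 3 := fun h => h.exists_seqClosure_eq_baireOne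
  tfae_have 3 → 2 := fun ⟨_, hS, hSc, h⟩ =>
    USCSpaces.uProperty_of_seqClosure_eq_baireOne hS hSc h
  tfae_finish
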